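/- Let $\Delta$ be a field and let $G$ be the free group on a totally ordered set $X$ with at least two elements. Order $G$ by the dictionary (Magnus) order: let $\mu$ be the Magnus expansion, that is, the group homomorphism from $G$ to the units of the ring of formal power series over $\mathbb{Z}$ in the non-commuting variables $x \in X$ with $\mu(x) = 1 + x$; order the monomials (words in $X$) first by length and then lexicographically; and put $g < h$ if and only if the coefficient of the first monomial occurring in $\mu(h) - \mu(g)$ is positive. This is a total order on $G$ invariant under left and right multiplication. Let $D = \Delta((G))$ be the Mal'cev–Neumann division ring, whose elements are the formal sums $\sum_{g \in G} a_g g$ with $a_g \in \Delta$ and well-ordered support $\{g : a_g \neq 0\}$, with termwise addition and with the multiplication $\left(\sum_g a_g g\right)\left(\sum_h b_h h\right) = \sum_{t}\left(\sum_{gh=t} a_g b_h\right) t$. A maximal subfield of $D$ is a commutative division subring $L \subseteq D$ that contains the center of $D$ and satisfies $C_D(L) = L$, where $C_D(L)$ is the centralizer of $L$ in $D$. For $A \subseteq D$ put $A^* = A \setminus \{0\}$ and $N_{D^*}(A) = \{b \in D^* : bAb^{-1} \subseteq A\}$. Then every maximal subfield $L$ of $D$ is self-invariant, i.e. $N_{D^*}(L^*)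 \cup \{0\} = L$. Moreover, $D$ is not commutative and has infinite dimension over its center; hence an infinite-dimensional division ring all of whose maximal subfields are self-invariant need not be commutative. -/

import Mathlib

set_option linter.unusedSectionVars false

/-- Formal sums `∑ a_g g` with coefficients in `R` and exponents in the totally ordered set `M`
whose support is well-ordered. -/
@[ext]
structure MalcevNeumann (R M : Type*) [Zero R] [LinearOrder M] where
  /-- the coefficient function `g ↦ a_g` -/
  coeff : M → R
  /-- the support is well-ordered -/
  isWF_support : (Function.support coeff).IsWF

namespace MalcevNeumann

section Additive

variable {R M : Type*} [LinearOrder M]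

/-- The support of a formal sum. -/
def supp [Zero R] (x : MalcevNeumann R M) : Set M := Function.support x.coeff

theorem mem_supp [Zero R] {x : MalcevNeumann R M} {g : M} : g ∈ x.supp ↔ x.coeff g ≠ 0 := Iff.rfl

theorem isPWO_supp [Zero R] (x : MalcevNeumann R M) : x.supp.IsPWO := x.isWF_support.isPWO

theorem coeff_injective [Zero R] :
    Function.Injective (coeff : MalcevNeumann R M → M → R) := fun _ _ h => MalcevNeumann.ext h

instance [Zero R] : Zero (MalcevNeumann R M) := ⟨⟨fun _ => 0, by simp⟩⟩

variable [AddCommGroup R]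

instance : Add (MalcevNeumann R M) :=
  ⟨fun x y => ⟨fun g => x.coeff g + y.coeff g,
    ((x.isPWO_supp.union y.isPWO_supp).mono (Function.support_add _ _)).isWF⟩⟩

instance : Neg (MalcevNeumann R M) :=
  ⟨fun x => ⟨fun g => -x.coeff g, by simpa only [Function.support_fun_neg] using x.isWF_support⟩⟩

instance : Sub (MalcevNeumann R M) :=
  ⟨fun x y => ⟨fun g => x.coeff g - y.coeff g,
    ((x.isPWO_supp.union y.isPWO_supp).mono (Function.support_sub _ _)).isWF⟩⟩

instance : SMul ℕ (MalcevNeumann R M) :=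
  ⟨fun n x => ⟨fun g => n • x.coeff g,
    (x.isPWO_supp.mono (Function.support_const_smul_subset n x.coeff)).isWF⟩⟩

instance : SMul ℤ (MalcevNeumann R M) :=
  ⟨fun n x => ⟨fun g => n • x.coeff g,
    (x.isPWO_supp.mono (Function.support_const_smul_subset n x.coeff)).isWF⟩⟩

@[simp] theorem coeff_zero (g : M) : (0 : MalcevNeumann R M).coeff g = 0 := rfl
@[simp] theorem coeff_add (x y : MalcevNeumann R M) (g : M) :
    (x + y).coeff g = x.coeff g + y.coeff g := rfl
@[simp] theorem coeff_neg (x : MalcevNeumann R M) (g : M) : (-x).coeff g = -x.coeff g := rfl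
@[simp] theorem coeff_sub (x y : MalcevNeumann R M) (g : M) :
    (x - y).coeff g = x.coeff g - y.coeff g := rfl

theorem supp_add (x y : MalcevNeumann R M) : (x + y).supp ⊆ x.supp ∪ y.supp :=
  Function.support_add _ _

instance : AddCommGroup (MalcevNeumann R M) :=
  coeff_injective.addCommGroup coeff rfl (fun _ _ => rfl) (fun _ => rfl) (fun _ _ => rfl)
    (fun _ _ => rfl) (fun _ _ => rfl)

end Additive

section Single

variable {R M : Type*} [LinearOrder M] [Zero R]

open Classical in
/-- The formal sum `a g` with a single term. -/
noncomputable def single (g : M) (a : R) : MalcevNeumann R M :=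
  ⟨fun h => if h = g then a else 0,
    ((Set.isPWO_singleton g).mono fun h hh => by
      by_contra hne
      exact hh (if_neg hne)).isWF⟩

@[simp] theorem coeff_single_same (g : M) (a : R) : (single g a).coeff g = a := if_pos rfl

theorem coeff_single_of_ne {g h : M} (a : R) (hne : h ≠ g) : (single g a).coeff h = 0 :=
  if_neg hne

end Single

section Mul

variable {R M : Type*} [Monoid M] [LinearOrder M] [MulLeftStrictMono M] [MulRightStrictMono M]

theorem strictMono_mul_left (c : M) : StrictMono (fun a : M => c * a) :=
  fun _ _ h => mul_lt_mul_right h c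

theorem strictMono_mul_right (c : M) : StrictMono (fun a : M => a * c) :=
  fun _ _ h => mul_lt_mul_left h c

theorem finite_pairs {s t : Set M} (hs : s.IsPWO) (ht : t.IsPWO) (a : M) :
    (s.mulAntidiagonal t a).Finite := by
  have : IsOrderedCancelSMul M M :=
    { smul_le_smul_left := fun a b h c => (strictMono_mul_left c).monotone h
      smul_le_smul_right := fun a b h c => (strictMono_mul_right c).monotone h
      le_of_smul_le_smul_left := fun a b c h => (strictMono_mul_left a).le_iff_le.1 h
      le_of_smul_le_smul_right := fun a b c h => (strictMono_mul_right c).le_iff_le.1 h }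
  exact Set.SMulAntidiagonal.finite_of_isPWO hs ht a

theorem isPWO_mul {s t : Set M} (hs : s.IsPWO) (ht : t.IsPWO) :
    {a | ∃ g ∈ s, ∃ h ∈ t, g * h = a}.IsPWO := by
  have : IsOrderedSMul M M :=
    { smul_le_smul_left := fun a b h c => (strictMono_mul_left c).monotone h
      smul_le_smul_right := fun a b h c => (strictMono_mul_right c).monotone h }
  exact hs.smul ht

/-- The finite set of the pairs `(g, h)` in `s × t` with `g h = a`, for well-ordered `s`, `t`. -/
noncomputable def pairs {s t : Set M} (hs : s.IsPWO) (ht : t.IsPWO) (a : M) : Finset (M × M) :=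
  (finite_pairs hs ht a).toFinset

theorem mem_pairs {s t : Set M} {hs : s.IsPWO} {ht : t.IsPWO} {a : M} {p : M × M} :
    p ∈ pairs hs ht a ↔ p.1 ∈ s ∧ p.2 ∈ t ∧ p.1 * p.2 = a := by
  simp [pairs]

section

variable [NonUnitalNonAssocSemiring R]

/-- The coefficient of a product: `∑_{g h = a} x_g y_h`, where only the finitely many pairs in the
supports contribute. -/
noncomputable def mulCoeff (x y : MalcevNeumann R M) (a : M) : R :=
  ∑ p ∈ pairs x.isPWO_supp y.isPWO_supp a, x.coeff p.1 * y.coeff p.2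

theorem mulCoeff_support (x y : MalcevNeumann R M) :
    Function.support (mulCoeff x y) ⊆ {a | ∃ g ∈ x.supp, ∃ h ∈ y.supp, g * h = a} := by
  intro a ha
  obtain ⟨p, hp, -⟩ := Finset.exists_ne_zero_of_sum_ne_zero ha
  obtain ⟨h1, h2, h3⟩ := mem_pairs.1 hp
  exact ⟨p.1, h1, p.2, h2, h3⟩

noncomputable instance : Mul (MalcevNeumann R M) :=
  ⟨fun x y => ⟨mulCoeff x y,
    ((isPWO_mul x.isPWO_supp y.isPWO_supp).mono (mulCoeff_support x y)).isWF⟩⟩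

theorem supp_mul (x y : MalcevNeumann R M) :
    (x * y).supp ⊆ {a | ∃ g ∈ x.supp, ∃ h ∈ y.supp, g * h = a} := mulCoeff_support x y

theorem coeff_mul (x y : MalcevNeumann R M) (a : M) : (x * y).coeff a =
    ∑ p ∈ pairs x.isPWO_supp y.isPWO_supp a, x.coeff p.1 * y.coeff p.2 := rfl

theorem coeff_mul_of_subset {x y : MalcevNeumann R M} {s t : Set M} (hs : s.IsPWO) (ht : t.IsPWO)
    (hx : x.supp ⊆ s) (hy : y.supp ⊆ t) (a : M) :
    (x * y).coeff a = ∑ p ∈ pairs hs ht a, x.coeff p.1 * y.coeff p.2 := by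
  rw [coeff_mul]
  refine Finset.sum_subset (fun p hp => ?_) (fun p hp hp' => ?_)
  · rw [mem_pairs] at hp ⊢
    exact ⟨hx hp.1, hy hp.2.1, hp.2.2⟩
  · rw [mem_pairs] at hp hp'
    by_cases h1 : x.coeff p.1 = 0
    · rw [h1, zero_mul]
    by_cases h2 : y.coeff p.2 = 0
    · rw [h2, mul_zero]
    exact absurd ⟨h1, h2, hp.2.2⟩ hp'

end

section Ring

variable [Ring R]

theorem single_mul_coeff (g : M) (r : R) (y : MalcevNeumann R M) (h : M) :
    (single g r * y).coeff (g * h) = r * y.coeff h := by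
  have hs : (single g r).supp ⊆ {g} := fun k hk => by
    by_contra hne
    exact hk (coeff_single_of_ne r hne)
  rw [coeff_mul_of_subset (Set.isPWO_singleton g) (y.isPWO_supp.union (Set.isPWO_singleton h)) hs
    Set.subset_union_left, Finset.sum_eq_single (g, h)]
  · simp
  · rintro ⟨p, q⟩ hp hne
    obtain ⟨h1, -, h3⟩ := mem_pairs.1 hp
    obtain rfl : p = g := h1
    exact absurd (congrArg (Prod.mk p) ((strictMono_mul_left p).injective h3)) hne
  · intro hn
    exact (hn (mem_pairs.2 ⟨rfl, Or.inr rfl, rfl⟩)).elim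

theorem mul_single_coeff (g : M) (r : R) (x : MalcevNeumann R M) (h : M) :
    (x * single g r).coeff (h * g) = x.coeff h * r := by
  have hs : (single g r).supp ⊆ {g} := fun k hk => by
    by_contra hne
    exact hk (coeff_single_of_ne r hne)
  rw [coeff_mul_of_subset (x.isPWO_supp.union (Set.isPWO_singleton h)) (Set.isPWO_singleton g)
    Set.subset_union_left hs, Finset.sum_eq_single (h, g)]
  · simp
  · rintro ⟨p, q⟩ hp hne
    obtain ⟨-, h1, h3⟩ := mem_pairs.1 hp
    obtain rfl : q = g := h1
    exact absurd (congrArg (·, q) ((strictMono_mul_right q).injective h3)) hne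
  · intro hn
    exact (hn (mem_pairs.2 ⟨Or.inr rfl, rfl, rfl⟩)).elim

noncomputable instance : One (MalcevNeumann R M) := ⟨single 1 1⟩

theorem mul_assoc_aux (x y z : MalcevNeumann R M) : x * y * z = x * (y * z) := by
  ext b
  rw [coeff_mul_of_subset (isPWO_mul x.isPWO_supp y.isPWO_supp) z.isPWO_supp (supp_mul x y)
    subset_rfl, coeff_mul_of_subset x.isPWO_supp (isPWO_mul y.isPWO_supp z.isPWO_supp) subset_rfl
    (supp_mul y z)]
  simp only [coeff_mul, Finset.sum_mul, Finset.mul_sum, Finset.sum_sigma']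
  refine Finset.sum_nbij' (fun p => ⟨(p.2.1, p.2.2 * p.1.2), (p.2.2, p.1.2)⟩)
    (fun p => ⟨(p.1.1 * p.2.1, p.2.2), (p.1.1, p.2.1)⟩) ?_ ?_ ?_ ?_ ?_
  · rintro ⟨⟨i, j⟩, ⟨k, l⟩⟩ hp
    simp only [Finset.mem_sigma, mem_pairs] at hp ⊢
    obtain ⟨⟨-, hj, rfl⟩, hk, hl, rfl⟩ := hp
    exact ⟨⟨hk, ⟨l, hl, j, hj, rfl⟩, (mul_assoc _ _ _).symm⟩, hl, hj, trivial⟩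
  · rintro ⟨⟨i, j⟩, ⟨k, l⟩⟩ hp
    simp only [Finset.mem_sigma, mem_pairs] at hp ⊢
    obtain ⟨⟨hi, -, rfl⟩, hk, hl, rfl⟩ := hp
    exact ⟨⟨⟨i, hi, k, hk, rfl⟩, hl, mul_assoc _ _ _⟩, hi, hk, trivial⟩
  · rintro ⟨⟨i, j⟩, ⟨k, l⟩⟩ hp
    simp only [Finset.mem_sigma, mem_pairs] at hp
    obtain ⟨-, -, -, rfl⟩ := hp
    rfl
  · rintro ⟨⟨i, j⟩, ⟨k, l⟩⟩ hp
    simp only [Finset.mem_sigma, mem_pairs] at hp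
    obtain ⟨-, -, -, rfl⟩ := hp
    rfl
  · rintro ⟨⟨i, j⟩, ⟨k, l⟩⟩ -
    exact mul_assoc _ _ _

noncomputable instance : Ring (MalcevNeumann R M) where
  __ := (inferInstance : AddCommGroup (MalcevNeumann R M))
  mul_assoc := mul_assoc_aux
  one_mul x := by
    ext g
    have := single_mul_coeff 1 1 x g
    rwa [one_mul, one_mul] at this
  mul_one x := by
    ext g
    have := mul_single_coeff 1 1 x g
    rwa [mul_one, mul_one] at this
  zero_mul x := by
    ext g
    simp [coeff_mul]
  mul_zero x := by
    ext g
    simp [coeff_mul]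
  left_distrib x y z := by
    ext g
    have h := y.isPWO_supp.union z.isPWO_supp
    rw [coeff_add, coeff_mul_of_subset x.isPWO_supp h subset_rfl (supp_add y z),
      coeff_mul_of_subset x.isPWO_supp h subset_rfl Set.subset_union_left,
      coeff_mul_of_subset x.isPWO_supp h subset_rfl Set.subset_union_right,
      ← Finset.sum_add_distrib]
    exact Finset.sum_congr rfl fun p _ => mul_add _ _ _
  right_distrib x y z := by
    ext g
    have h := x.isPWO_supp.union y.isPWO_supp
    rw [coeff_add, coeff_mul_of_subset h z.isPWO_supp (supp_add x y) subset_rfl,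
      coeff_mul_of_subset h z.isPWO_supp Set.subset_union_left subset_rfl,
      coeff_mul_of_subset h z.isPWO_supp Set.subset_union_right subset_rfl,
      ← Finset.sum_add_distrib]
    exact Finset.sum_congr rfl fun p _ => add_mul _ _ _
  zsmul := fun n x => n • x
  zsmul_zero' := fun x => zero_zsmul x
  zsmul_succ' := fun n x => SubNegMonoid.zsmul_succ' n x
  zsmul_neg' := fun n x => SubNegMonoid.zsmul_neg' n x

@[simp] theorem coeff_one_one : (1 : MalcevNeumann R M).coeff 1 = 1 := coeff_single_same _ _

theorem coeff_one_of_ne {g : M} (h : g ≠ 1) : (1 : MalcevNeumann R M).coeff g = 0 :=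
  coeff_single_of_ne _ h

theorem isPWO_closure {s : Set M} (hs : s.IsPWO) (h1 : ∀ g ∈ s, 1 < g) :
    (Submonoid.closure s : Set M).IsPWO := by
  have : MulLeftMono M := ⟨fun c _ _ h => (strictMono_mul_left c).monotone h⟩
  have : MulRightMono M := ⟨fun c _ _ h => (strictMono_mul_right c).monotone h⟩
  rw [Submonoid.closure_eq_image_prod]
  refine (hs.partiallyWellOrderedOn_sublistForall₂ (· ≤ ·)).image_of_monotone_on ?_
  exact fun l1 _ l2 hl2 h12 => h12.prod_le_prod' fun x hx => (h1 x <| hl2 x hx).le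

/-- If all exponents of `x` are larger than `1`, then `1 - x` has a right inverse of the same
form. -/
theorem exists_right_inv_one_sub (x : MalcevNeumann R M) (hx : ∀ g ∈ x.supp, 1 < g) :
    ∃ y : MalcevNeumann R M, (∀ g ∈ y.supp, 1 < g) ∧ (1 - x) * (1 - y) = 1 := by
  classical
  have hT := isPWO_closure x.isPWO_supp hx
  set T : Set M := (Submonoid.closure x.supp : Set M) with hTdef
  have hlt : ∀ {a : M} (p : {p // p ∈ pairs x.isPWO_supp hT a}), p.1.2 < a := by
    rintro a ⟨p, hp⟩
    obtain ⟨h1, -, h3⟩ := mem_pairs.1 hp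
    have h4 := strictMono_mul_right p.2 (hx _ h1)
    simp only [one_mul, h3] at h4
    exact h4
  let c : T → R := hT.isWF.fix fun a ih =>
    (if (a : M) = 1 then 1 else 0) + ∑ p ∈ (pairs x.isPWO_supp hT (a : M)).attach,
      x.coeff p.1.1 * ih ⟨p.1.2, (mem_pairs.1 p.2).2.1⟩ (hlt p)
  have hc : ∀ a : T, c a = (if (a : M) = 1 then 1 else 0) +
      ∑ p ∈ (pairs x.isPWO_supp hT (a : M)).attach,
        x.coeff p.1.1 * c ⟨p.1.2, (mem_pairs.1 p.2).2.1⟩ := fun a => WellFounded.fix_eq _ _ a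
  let d : M → R := fun a => if h : a ∈ T then c ⟨a, h⟩ else 0
  have hdT : Function.support d ⊆ T := fun a ha => by
    by_contra hn
    exact ha (dif_neg hn)
  let t : MalcevNeumann R M := ⟨d, (hT.mono hdT).isWF⟩
  have key : (1 - x) * t = 1 := by
    rw [sub_mul, one_mul]
    ext a
    rw [coeff_sub, coeff_mul_of_subset x.isPWO_supp hT subset_rfl (y := t) hdT]
    by_cases ha : a ∈ T
    · have h1 : t.coeff a = c ⟨a, ha⟩ := dif_pos ha
      rw [h1, hc, ← Finset.sum_attach (pairs x.isPWO_supp hT a)]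
      have h2 : ∀ p ∈ (pairs x.isPWO_supp hT a).attach, x.coeff p.1.1 * t.coeff p.1.2 =
          x.coeff p.1.1 * c ⟨p.1.2, (mem_pairs.1 p.2).2.1⟩ := fun p _ =>
        congrArg _ (dif_pos (mem_pairs.1 p.2).2.1)
      rw [Finset.sum_congr rfl h2, add_sub_cancel_right]
      rfl
    · have h1 : t.coeff a = 0 := dif_neg ha
      rw [h1, Finset.sum_eq_zero, sub_zero, coeff_one_of_ne]
      · rintro rfl
        exact ha (Submonoid.one_mem _)
      · intro p hp
        obtain ⟨hp1, hp2, rfl⟩ := mem_pairs.1 hp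
        exact (ha (Submonoid.mul_mem _ (Submonoid.subset_closure hp1) hp2)).elim
  have hT1 : ∀ a ∈ T, 1 ≤ a := by
    intro a ha
    induction ha using Submonoid.closure_induction with
    | mem a ha => exact (hx a ha).le
    | one => exact le_rfl
    | mul a b _ _ h1 h2 =>
      calc (1 : M) ≤ b := h2
        _ = 1 * b := (one_mul b).symm
        _ ≤ a * b := (strictMono_mul_right b).monotone h1
  refine ⟨1 - t, fun g hg => ?_, by rwa [sub_sub_cancel]⟩
  have h1T : (1 : M) ∈ T := Submonoid.one_mem _
  have hgT : g ∈ T := by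
    by_contra hn
    refine hg ?_
    rw [coeff_sub, coeff_one_of_ne (fun h : g = 1 => hn (h ▸ h1T)), zero_sub, neg_eq_zero]
    exact dif_neg hn
  refine lt_of_le_of_ne (hT1 g hgT) fun h => hg ?_
  subst h
  have h1 : t.coeff 1 = c ⟨1, h1T⟩ := dif_pos h1T
  rw [coeff_sub, h1, hc, Finset.sum_eq_zero]
  · simp
  · rintro p -
    exact absurd (hlt p) (not_lt_of_ge (hT1 _ (mem_pairs.1 p.2).2.1))

theorem isUnit_one_sub (x : MalcevNeumann R M) (hx : ∀ g ∈ x.supp, 1 < g) : IsUnit (1 - x) := by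
  obtain ⟨y, hy, hxy⟩ := exists_right_inv_one_sub x hx
  obtain ⟨z, hz, hyz⟩ := exists_right_inv_one_sub y hy
  have : 1 - x = 1 - z := by
    calc 1 - x = (1 - x) * ((1 - y) * (1 - z)) := by rw [hyz, mul_one]
      _ = 1 - z := by rw [← mul_assoc, hxy, one_mul]
  exact ⟨⟨1 - x, 1 - y, hxy, by rw [this, hyz]⟩, rfl⟩

end Ring

end Mul

section Division

variable {R G : Type*} [DivisionRing R] [Group G] [LinearOrder G] [MulLeftStrictMono G]
  [MulRightStrictMono G]

theorem exists_mul_eq_one {x : MalcevNeumann R G} (hx : x ≠ 0) :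
    ∃ y : MalcevNeumann R G, x * y = 1 := by
  have hne : x.supp.Nonempty := by
    by_contra hn
    refine hx (MalcevNeumann.ext (funext fun g => ?_))
    by_contra hg
    exact hn ⟨g, hg⟩
  set m := x.isWF_support.min hne with hm
  have hm0 : x.coeff m ≠ 0 := x.isWF_support.min_mem hne
  set u : MalcevNeumann R G := single m⁻¹ (x.coeff m)⁻¹ with hu
  have hcoeff : ∀ g, (x * u).coeff g = x.coeff (g * m) * (x.coeff m)⁻¹ := fun g => by
    have := mul_single_coeff m⁻¹ (x.coeff m)⁻¹ x (g * m)
    rwa [mul_inv_cancel_right] at this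
  have hunit : IsUnit (1 - (1 - x * u)) := by
    refine isUnit_one_sub _ fun g hg => ?_
    rcases lt_trichotomy g 1 with h | rfl | h
    · refine absurd ?_ hg
      rw [coeff_sub, coeff_one_of_ne h.ne, hcoeff, zero_sub, neg_eq_zero]
      have : x.coeff (g * m) = 0 := by
        by_contra hn
        have h1 := x.isWF_support.min_le hne hn
        have h2 : g * m < 1 * m := strictMono_mul_right m h
        rw [one_mul] at h2
        exact absurd h1 (not_le_of_gt h2)
      rw [this, zero_mul]
    · refine absurd ?_ hg
      rw [coeff_sub, coeff_one_one, hcoeff, one_mul, mul_inv_cancel₀ hm0, sub_self]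
    · exact h
  rw [sub_sub_cancel] at hunit
  obtain ⟨w, hw⟩ := hunit.exists_right_inv
  exact ⟨u * w, by rw [← mul_assoc, hw]⟩

open Classical in
/-- The Mal'cev–Neumann division ring `R((G))` of an ordered group `G` over `R`. -/
noncomputable instance : DivisionRing (MalcevNeumann R G) where
  inv x := if h : x = 0 then 0 else (exists_mul_eq_one h).choose
  exists_pair_ne := ⟨0, 1, fun h => zero_ne_one (α := R) <| by
    simpa using congrArg (fun x : MalcevNeumann R G => x.coeff 1) h⟩
  mul_inv_cancel x hx := by
    change x * (if h : x = 0 then 0 else (exists_mul_eq_one h).choose) = 1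
    rw [dif_neg hx]
    exact (exists_mul_eq_one hx).choose_spec
  inv_zero := dif_pos rfl
  nnqsmul := _
  nnqsmul_def := fun _ _ => rfl
  qsmul := _
  qsmul_def := fun _ _ => rfl

end Division

end MalcevNeumann

namespace Magnus

open MalcevNeumann

section Words

variable {X : Type*} [LinearOrder X]

/-- Words are ordered first by length and then lexicographically. -/
noncomputable instance : LinearOrder (FreeMonoid X) :=
  LinearOrder.lift' (fun w : FreeMonoid X => toLex (w.toList.length, w.toList)) fun _ _ h =>
    FreeMonoid.toList.injective (congrArg Prod.snd (toLex.injective h))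

theorem word_lt_iff {v w : FreeMonoid X} : v < w ↔ v.toList.length < w.toList.length ∨
    v.toList.length = w.toList.length ∧ v.toList < w.toList :=
  Prod.Lex.toLex_lt_toLex

theorem lex_append_right {l₁ l₂ : List X} (h : l₁ < l₂) (hl : l₁.length = l₂.length)
    (l : List X) : l₁ ++ l < l₂ ++ l := by
  have h' : List.Lex (· < ·) l₁ l₂ := h
  change List.Lex (· < ·) (l₁ ++ l) (l₂ ++ l)
  clear h
  induction h' with
  | nil => simp at hl
  | cons _ ih => exact List.Lex.cons (ih (by simpa using hl))
  | rel h => exact List.Lex.rel h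

instance : MulLeftStrictMono (FreeMonoid X) := ⟨fun c a b h => by
  rw [word_lt_iff] at h ⊢
  simp only [FreeMonoid.toList_mul, List.length_append, add_lt_add_iff_left, add_right_inj]
  exact h.imp_right fun h => ⟨h.1, List.Lex.append_left (· < ·) h.2 c.toList⟩⟩

instance : MulRightStrictMono (FreeMonoid X) := ⟨fun c a b h => by
  rw [word_lt_iff] at h
  change a * c < b * c
  rw [word_lt_iff]
  simp only [FreeMonoid.toList_mul, List.length_append, add_lt_add_iff_right, add_left_inj]
  exact h.imp_right fun h => ⟨h.1, lex_append_right h.2 h.1 c.toList⟩⟩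

theorem one_lt_of (x : X) : 1 < FreeMonoid.of x := word_lt_iff.2 (Or.inl (by simp))

theorem one_le_word (w : FreeMonoid X) : 1 ≤ w := by
  refine not_lt.1 fun h => ?_
  rw [word_lt_iff] at h
  rcases h with h | ⟨-, h⟩
  · simp at h
  · exact absurd (show List.Lex (· < ·) w.toList [] from h) (by simp)

end Words

section Series

variable (X : Type*) [LinearOrder X]

/-- Formal power series over `ℤ` in the non-commuting variables `X`, with well-ordered support.
For finite `X` these are all formal power series, since every set of words is then well-ordered. -/
abbrev Series : Type _ := MalcevNeumann ℤ (FreeMonoid X)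

variable {X}

/-- The variable `x` as a power series. -/
noncomputable def var (x : X) : Series X := single (FreeMonoid.of x) 1

theorem isUnit_one_add_var (x : X) : IsUnit (1 + var x) := by
  rw [← sub_neg_eq_add]
  refine isUnit_one_sub _ fun g hg => ?_
  obtain rfl : g = FreeMonoid.of x := by
    by_contra hne
    refine hg ?_
    rw [coeff_neg, var, coeff_single_of_ne _ hne, neg_zero]
  exact one_lt_of x

variable (X) in
/-- The Magnus expansion: the homomorphism with `x ↦ 1 + x` for every generator `x`. -/
noncomputable def expansion : FreeGroup X →* (Series X)ˣ :=
  FreeGroup.lift fun x => (isUnit_one_add_var x).unit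

/-- A power series is positive if the coefficient of the first word in its support is positive. -/
def Positive (f : Series X) : Prop :=
  ∃ w : FreeMonoid X, 0 < f.coeff w ∧ ∀ v < w, f.coeff v = 0

theorem expansion_of (x : X) : (expansion X (FreeGroup.of x) : Series X) = 1 + var x := by
  simp [expansion]

theorem coeff_var_mul_nil (x : X) (f : Series X) : (var x * f).coeff 1 = 0 := by
  by_contra h
  obtain ⟨g, hg, k, -, hgk⟩ := supp_mul (var x) f h
  obtain rfl : g = FreeMonoid.of x := by
    by_contra hne
    exact hg (coeff_single_of_ne _ hne)
  simpa using congrArg FreeMonoid.toList hgk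

theorem coeff_var_mul_of_mul (x : X) (f : Series X) (w : FreeMonoid X) :
    (var x * f).coeff (FreeMonoid.of x * w) = f.coeff w := by
  rw [var, single_mul_coeff, one_mul]

theorem coeff_var_mul_of_ne {x y : X} (hxy : y ≠ x) (f : Series X) (w : FreeMonoid X) :
    (var x * f).coeff (FreeMonoid.of y * w) = 0 := by
  by_contra h
  obtain ⟨g, hg, k, -, hgk⟩ := supp_mul (var x) f h
  obtain rfl : g = FreeMonoid.of x := by
    by_contra hne
    exact hg (coeff_single_of_ne _ hne)
  have := congrArg FreeMonoid.toList hgk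
  simp only [FreeMonoid.toList_mul, FreeMonoid.toList_of, List.cons_append, List.cons.injEq] at this
  exact hxy this.1.symm

theorem coeff_mul_nil (f g : Series X) : (f * g).coeff 1 = f.coeff 1 * g.coeff 1 := by
  rw [coeff_mul_of_subset (f.isPWO_supp.union (Set.isPWO_singleton 1))
    (g.isPWO_supp.union (Set.isPWO_singleton 1)) Set.subset_union_left Set.subset_union_left,
    Finset.sum_eq_single (1, 1)]
  · rintro ⟨p, q⟩ hp hne
    obtain ⟨-, -, h⟩ := mem_pairs.1 hp
    have h' := congrArg FreeMonoid.toList h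
    simp only [FreeMonoid.toList_mul, FreeMonoid.toList_one, List.append_eq_nil_iff] at h'
    exact absurd (Prod.ext (FreeMonoid.toList.injective h'.1) (FreeMonoid.toList.injective h'.2))
      hne
  · intro hn
    exact (hn (mem_pairs.2 ⟨Or.inr rfl, Or.inr rfl, one_mul _⟩)).elim

theorem coeff_expansion_nil (g : FreeGroup X) : (expansion X g : Series X).coeff 1 = 1 := by
  induction g using FreeGroup.induction_on with
  | C1 => simp
  | of x =>
    have h := coeff_var_mul_nil x 1
    rw [mul_one] at h
    rw [expansion_of, coeff_add, h, coeff_one_one, add_zero]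
  | inv_of x ih =>
    have h := coeff_mul_nil (expansion X (FreeGroup.of x) : Series X)
      (expansion X (FreeGroup.of x)⁻¹ : Series X)
    rw [ih, one_mul, ← Units.val_mul, ← map_mul, mul_inv_cancel, map_one, Units.val_one,
      coeff_one_one] at h
    exact h.symm
  | mul a b iha ihb => rw [map_mul, Units.val_mul, coeff_mul_nil, iha, ihb, one_mul]

theorem positive_expansion (g : FreeGroup X) : Positive (expansion X g : Series X) :=
  ⟨1, by simp [coeff_expansion_nil], fun v hv => absurd (one_le_word v) (not_le_of_gt hv)⟩

theorem Positive.add {f g : Series X} (hf : Positive f) (hg : Positive g) : Positive (f + g) := by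
  obtain ⟨v, hv, hv'⟩ := hf
  obtain ⟨w, hw, hw'⟩ := hg
  rcases lt_trichotomy v w with h | rfl | h
  · exact ⟨v, by simpa [hw' v h] using hv, fun u hu => by simp [hv' u hu, hw' u (hu.trans h)]⟩
  · exact ⟨v, by simpa using add_pos hv hw, fun u hu => by simp [hv' u hu, hw' u hu]⟩
  · exact ⟨w, by simpa [hv' w h] using hw, fun u hu => by simp [hw' u hu, hv' u (hu.trans h)]⟩

theorem Positive.mul {f g : Series X} (hf : Positive f) (hg : Positive g) : Positive (f * g) := by
  obtain ⟨v, hv, hv'⟩ := hf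
  obtain ⟨w, hw, hw'⟩ := hg
  have hle : ∀ p ∈ f.supp, v ≤ p := fun p hp => not_lt.1 fun h => hp (hv' p h)
  have hle' : ∀ p ∈ g.supp, w ≤ p := fun p hp => not_lt.1 fun h => hp (hw' p h)
  refine ⟨v * w, ?_, fun u hu => ?_⟩
  · rw [coeff_mul, Finset.sum_eq_single (v, w)]
    · exact mul_pos hv hw
    · rintro ⟨p, q⟩ hp hne
      obtain ⟨h1, h2, h3⟩ := mem_pairs.1 hp
      exfalso
      rcases (hle p h1).lt_or_eq with h | h
      · have h4 : v * w < p * w := strictMono_mul_right w h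
        have h5 : p * w ≤ p * q := (strictMono_mul_left p).monotone (hle' q h2)
        exact absurd h3 (h4.trans_le h5).ne'
      · subst h
        exact hne (congrArg (Prod.mk v) ((strictMono_mul_left v).injective h3))
    · intro hn
      exact (hn (mem_pairs.2 ⟨hv.ne', hw.ne', rfl⟩)).elim
  · by_contra hne
    obtain ⟨p, hp, q, hq, rfl⟩ := supp_mul f g hne
    have h4 : v * w ≤ p * w := (strictMono_mul_right w).monotone (hle p hp)
    have h5 : p * w ≤ p * q := (strictMono_mul_left p).monotone (hle' q hq)
    exact absurd hu (not_lt_of_ge (h4.trans h5))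

theorem not_positive_zero : ¬ Positive (0 : Series X) := by
  rintro ⟨w, hw, -⟩
  exact absurd hw (lt_irrefl _)

theorem positive_or_positive_neg {f : Series X} (hf : f ≠ 0) : Positive f ∨ Positive (-f) := by
  have hne : f.supp.Nonempty := by
    by_contra hn
    refine hf (MalcevNeumann.ext (funext fun g => ?_))
    by_contra hg
    exact hn ⟨g, hg⟩
  have hlow : ∀ v < f.isWF_support.min hne, f.coeff v = 0 := fun v hv => by
    by_contra h
    exact absurd (f.isWF_support.min_le hne h) (not_le_of_gt hv)
  rcases lt_or_gt_of_ne (f.isWF_support.min_mem hne) with h | h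
  · exact Or.inr ⟨_, by simpa using h, fun v hv => by simp [hlow v hv]⟩
  · exact Or.inl ⟨_, h, hlow⟩

/-- Words without two equal adjacent letters. -/
abbrev Alternating (w : List X) : Prop := w.IsChain (· ≠ ·)

theorem coeff_zpow_mul (x : X) (f : Series X) (n : ℤ) :
    (∀ w : List X, Alternating (x :: w) →
      (((expansion X (FreeGroup.of x)) ^ n : (Series X)ˣ) * f : Series X).coeff
          (FreeMonoid.ofList (x :: w)) =
        f.coeff (FreeMonoid.ofList (x :: w)) + n * f.coeff (FreeMonoid.ofList w)) ∧
    (∀ w : List X, w.head? ≠ some x →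
      (((expansion X (FreeGroup.of x)) ^ n : (Series X)ˣ) * f : Series X).coeff
        (FreeMonoid.ofList w) = f.coeff (FreeMonoid.ofList w)) := by
  set u := expansion X (FreeGroup.of x) with hu
  have hx : ∀ (g : Series X) (w : List X), ((u : Series X) * g).coeff (FreeMonoid.ofList (x :: w)) =
      g.coeff (FreeMonoid.ofList (x :: w)) + g.coeff (FreeMonoid.ofList w) := by
    intro g w
    rw [hu, expansion_of, add_mul, one_mul, coeff_add]
    exact congrArg _ (coeff_var_mul_of_mul x g (FreeMonoid.ofList w))
  have hnx : ∀ (g : Series X) (w : List X), w.head? ≠ some x →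
      ((u : Series X) * g).coeff (FreeMonoid.ofList w) = g.coeff (FreeMonoid.ofList w) := by
    intro g w hw
    rw [hu, expansion_of, add_mul, one_mul, coeff_add]
    cases w with
    | nil =>
      have := coeff_var_mul_nil x g
      exact (congrArg _ this).trans (add_zero _)
    | cons y w =>
      have := coeff_var_mul_of_ne (x := x) (y := y) (by simpa using hw) g (FreeMonoid.ofList w)
      exact (congrArg _ this).trans (add_zero _)
  have halt : ∀ w : List X, Alternating (x :: w) → w.head? ≠ some x := by
    rintro (_ | ⟨y, w⟩) hw
    · simp
    · simp only [Alternating, List.isChain_cons_cons] at hw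
      simpa using hw.1.symm
  induction n with
  | zero => simp
  | succ n ih =>
    have hs : ((u ^ ((n : ℤ) + 1) : (Series X)ˣ) * f : Series X) =
        u * ((u ^ (n : ℤ) : (Series X)ˣ) * f) := by
      rw [← mul_assoc, ← Units.val_mul, add_comm, zpow_add, zpow_one]
    rw [hs]
    refine ⟨fun w hw => ?_, fun w hw => ?_⟩
    · rw [hx, ih.1 w hw, ih.2 w (halt w hw)]
      ring
    · rw [hnx _ w hw, ih.2 w hw]
  | pred n ih =>
    have hs : ((u ^ (-(n : ℤ)) : (Series X)ˣ) * f : Series X) =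
        u * ((u ^ (-(n : ℤ) - 1) : (Series X)ˣ) * f) := by
      rw [← mul_assoc, ← Units.val_mul]
      congr 2
      rw [← zpow_one_add]
      congr 1
      ring
    rw [hs] at ih
    have h2 : ∀ w : List X, w.head? ≠ some x →
        ((u ^ (-(n : ℤ) - 1) : (Series X)ˣ) * f : Series X).coeff
        (FreeMonoid.ofList w) = f.coeff (FreeMonoid.ofList w) := fun w hw => by
      rw [← ih.2 w hw, hnx _ w hw]
    refine ⟨fun w hw => ?_, h2⟩
    have h1 := ih.1 w hw
    rw [hx, h2 w (halt w hw)] at h1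
    linear_combination h1

theorem coeff_syllables (l : List (Σ _ : X, FreeGroup Unit)) (h1 : ∀ p ∈ l, p.2 ≠ 1)
    (hl : l.IsChain fun p q => p.1 ≠ q.1) :
    ∃ g : Series X,
      g = ((l.map fun p => expansion X (FreeGroup.lift (fun _ => FreeGroup.of p.1) p.2)).prod :
        (Series X)ˣ) ∧
      g.coeff (FreeMonoid.ofList (l.map Sigma.fst)) ≠ 0 ∧
      ∀ w : List X, Alternating w → l.length < w.length → g.coeff (FreeMonoid.ofList w) = 0 := by
  induction l with
  | nil =>
    refine ⟨1, by simp, by simp, fun w _ hw => coeff_one_of_ne fun h => ?_⟩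
    have : w = [] := congrArg FreeMonoid.toList h
    simp [this] at hw
  | cons p l ih =>
    obtain ⟨x, a⟩ := p
    obtain ⟨g, hg, hne, hz⟩ := ih (fun p hp => h1 p (List.mem_cons_of_mem _ hp)) hl.of_cons
    obtain ⟨n, rfl⟩ : ∃ n : ℤ, FreeGroup.of () ^ n = a :=
      FreeGroup.freeGroupUnitEquivInt.symm.surjective a
    have hn : n ≠ 0 := by
      rintro rfl
      exact h1 ⟨x, FreeGroup.of () ^ (0 : ℤ)⟩ List.mem_cons_self (zpow_zero _)
    obtain ⟨hx, hnx⟩ := coeff_zpow_mul x g n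
    have halt : Alternating (x :: l.map Sigma.fst) := by
      have : Alternating ((⟨x, FreeGroup.of () ^ n⟩ :: l).map Sigma.fst) :=
        (List.isChain_map _).2 hl
      simpa using this
    refine ⟨((expansion X (FreeGroup.of x)) ^ n : (Series X)ˣ) * g, ?_, ?_, fun w hw hlen => ?_⟩
    · simp [hg]
    · rw [List.map_cons, hx _ halt, hz _ halt (by simp), zero_add]
      exact mul_ne_zero (Int.cast_ne_zero.2 hn) hne
    · cases w with
      | nil => simp at hlen
      | cons y w =>
        simp only [List.length_cons, add_lt_add_iff_right] at hlen
        by_cases hy : y = x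
        · subst hy
          rw [hx w hw, hz _ hw (by simp; omega), hz w hw.of_cons hlen]
          simp
        · rw [hnx _ (by simpa using hy), hz _ hw (by simp; omega)]

theorem expansion_injective : Function.Injective (expansion X) := by
  classical
  rw [injective_iff_map_eq_one]
  intro g hg
  set c := freeGroupEquivCoprodI g with hc
  set w := Monoid.CoprodI.Word.equiv c with hw
  obtain ⟨f, hf, hne, -⟩ := coeff_syllables w.toList w.ne_one w.chain_ne
  have hprod : w.prod = c := Monoid.CoprodI.Word.equiv.symm_apply_apply c
  have key : ((w.toList.map fun p =>
      expansion X (FreeGroup.lift (fun _ => FreeGroup.of p.1) p.2)).prod : (Series X)ˣ) =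
      expansion X g := by
    have h1 : g = freeGroupEquivCoprodI.symm w.prod := by
      rw [hprod, hc, MulEquiv.symm_apply_apply]
    conv_rhs => rw [h1, Monoid.CoprodI.Word.prod, map_list_prod, map_list_prod, List.map_map,
      List.map_map]
    congr 1
  rw [key, hg, Units.val_one] at hf
  subst hf
  have hnil : w.toList = [] := by
    by_contra hn
    refine hne (coeff_one_of_ne fun h => hn ?_)
    have : w.toList.map Sigma.fst = [] := congrArg FreeMonoid.toList h
    simpa using this
  have : c = 1 := by rw [← hprod, Monoid.CoprodI.Word.prod, hnil]; rfl
  exact (MulEquiv.map_eq_one_iff _).1 this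

end Series

section Order

variable {X : Type*} [LinearOrder X]

theorem expansion_sub_ne_zero {g h : FreeGroup X} (hgh : g ≠ h) :
    (expansion X h - expansion X g : Series X) ≠ 0 := fun h0 =>
  hgh (expansion_injective (Units.ext (sub_eq_zero.1 h0).symm))

open Classical in
/-- The Magnus (dictionary) order of the free group on a totally ordered set `X`: `g < h` if and
only if, in the Magnus expansion of `h` minus that of `g`, the coefficient of the first word that
occurs is positive. Words are compared first by length and then lexicographically. -/
noncomputable instance : LinearOrder (FreeGroup X) where
  le g h := g = h ∨ Positive (expansion X h - expansion X g : Series X)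
  lt g h := Positive (expansion X h - expansion X g : Series X)
  le_refl g := Or.inl rfl
  le_trans a b c := by
    rintro (rfl | hab) (rfl | hbc)
    · exact Or.inl rfl
    · exact Or.inr hbc
    · exact Or.inr hab
    · exact Or.inr (by simpa using hab.add hbc)
  lt_iff_le_not_ge a b := by
    constructor
    · intro h
      refine ⟨Or.inr h, ?_⟩
      rintro (rfl | h')
      · exact not_positive_zero (by simpa using h)
      · exact not_positive_zero (by simpa using h.add h')
    · rintro ⟨rfl | h, h'⟩
      · exact absurd (Or.inl rfl) h'
      · exact h
  le_antisymm a b := by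
    rintro (h | h) (h' | h')
    · exact h
    · exact h
    · exact h'.symm
    · exact (not_positive_zero (by simpa using h.add h')).elim
  le_total a b := by
    by_cases hab : a = b
    · exact Or.inl (Or.inl hab)
    · rcases positive_or_positive_neg (expansion_sub_ne_zero hab) with h | h
      · exact Or.inl (Or.inr h)
      · exact Or.inr (Or.inr (by simpa using h))
  toDecidableLE := Classical.decRel _

theorem lt_iff {g h : FreeGroup X} :
    g < h ↔ Positive (expansion X h - expansion X g : Series X) := Iff.rfl

instance : MulLeftStrictMono (FreeGroup X) := ⟨fun c a b h => by
  rw [lt_iff] at h ⊢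
  simpa [mul_sub] using (positive_expansion c).mul h⟩

instance : MulRightStrictMono (FreeGroup X) := ⟨fun c a b h => by
  change a * c < b * c
  rw [lt_iff] at h ⊢
  simpa [sub_mul] using h.mul (positive_expansion c)⟩

end Order

end Magnus

section Subfields

variable {D : Type*} [DivisionRing D]

/-- The normalizer `N_{D^*}(A) = {b ∈ D^* | b A b⁻¹ ⊆ A}` of a subset `A` of `D`. -/
def unitsNormalizer (A : Set D) : Set D := {b | b ≠ 0 ∧ ∀ a ∈ A, b * a * b⁻¹ ∈ A}

/-- A maximal subfield of `D`: a commutative division subring that contains the center of `D` and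
is its own centralizer in `D`. -/
structure IsMaximalSubfield (K : Subfield D) : Prop where
  mul_comm : ∀ a ∈ K, ∀ b ∈ K, a * b = b * a
  center_subset : Set.center D ⊆ (K : Set D)
  centralizer_eq : Set.centralizer (K : Set D) = (K : Set D)

/-- `K` is self-invariant if `N_{D^*}(K^*) ∪ {0} = K`, where `K^* = K \ {0}`. -/
def IsSelfInvariant (K : Subfield D) : Prop :=
  unitsNormalizer ((K : Set D) \ {0}) ∪ {0} = (K : Set D)

end Subfields

/-! Every maximal subfield `L` can be conjugated into the series supported in the centralizer `C` of
one group element, and there normalizing forces centralizing.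

The constants are central and `D` is not commutative, so `L` contains a series with leading exponent
`g ≠ 1`, which is scaled to leading coefficient 1. By `exists_conj_supp_subset_centralizer`, some
`x` conjugates it to a series with the same leading term `g` and support in `C = C_G(g)`. By
`supp_subset_centralizer_of_commute`, everything that commutes with this series is supported in `C`,
so `x⁻¹ L x` is. In a free group `C` is cyclic.

Let `b` normalize `L`, and write a prime for conjugation by `x`, so that `b' a' = (b a b⁻¹)' b'` for
`a ∈ L`. Applied to the normalized series, leading exponents show that the leading exponent `h` of
`b'` conjugates `g` into `C`. In an ordered free group this forces `h ∈ C`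
(`commute_of_conj_commute`), so the `C`-part of `b'` is not zero. Projection to exponents in `C` is
linear over the series supported in `C`, which commute with each other. Hence the projected identity
can be cancelled to `a = b a b⁻¹`: `b` centralizes `L`, so `b ∈ L`.

The argument uses only that the order of the free group is bi-invariant. For the infinite dimension,
the center is the field of constants, over which the powers of a free generator are independent. -/

namespace MalcevNeumann

/-! ### Restriction of a series to a set of exponents. -/

section Projection

variable {R M : Type*} [LinearOrder M]

/-- The part of a formal sum that is supported in `S`. -/
noncomputable def proj [Zero R] (S : Set M) (x : MalcevNeumann R M) : MalcevNeumann R M :=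
  ⟨S.indicator x.coeff, (x.isPWO_supp.mono (Set.support_indicator.trans_subset
    Set.inter_subset_right)).isWF⟩

theorem coeff_proj_of_mem [Zero R] {S : Set M} (x : MalcevNeumann R M) {g : M} (hg : g ∈ S) :
    (proj S x).coeff g = x.coeff g := Set.indicator_of_mem hg _

theorem coeff_proj_of_notMem [Zero R] {S : Set M} (x : MalcevNeumann R M) {g : M} (hg : g ∉ S) :
    (proj S x).coeff g = 0 := Set.indicator_of_notMem hg _

theorem supp_proj [Zero R] (S : Set M) (x : MalcevNeumann R M) :
    (proj S x).supp ⊆ S ∩ x.supp := by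
  intro g hg
  by_cases h : g ∈ S
  · rw [mem_supp, coeff_proj_of_mem x h] at hg
    exact ⟨h, hg⟩
  · exact absurd (coeff_proj_of_notMem x h) hg

theorem proj_eq_self [Zero R] {S : Set M} {x : MalcevNeumann R M} (hx : x.supp ⊆ S) :
    proj S x = x := by
  ext g
  by_cases h : g ∈ S
  · exact coeff_proj_of_mem x h
  · rw [coeff_proj_of_notMem x h]
    by_contra hne
    exact h (hx (Ne.symm hne))

theorem proj_eq_zero [AddCommGroup R] {S : Set M} {x : MalcevNeumann R M}
    (hx : ∀ g ∈ S, x.coeff g = 0) : proj S x = 0 := by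
  ext g
  by_cases h : g ∈ S
  · exact (coeff_proj_of_mem x h).trans (hx g h)
  · exact coeff_proj_of_notMem x h

theorem proj_add [AddCommGroup R] (S : Set M) (x y : MalcevNeumann R M) :
    proj S (x + y) = proj S x + proj S y := by
  ext g
  exact congrFun (Set.indicator_add S x.coeff y.coeff) g

theorem proj_sub [AddCommGroup R] (S : Set M) (x y : MalcevNeumann R M) :
    proj S (x - y) = proj S x - proj S y := by
  ext g
  exact congrFun (Set.indicator_sub S x.coeff y.coeff) g

theorem supp_add_subset [AddCommGroup R] {x y : MalcevNeumann R M} {S : Set M} (hx : x.supp ⊆ S)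
    (hy : y.supp ⊆ S) : (x + y).supp ⊆ S :=
  (supp_add x y).trans (Set.union_subset hx hy)

theorem supp_sub [AddCommGroup R] (x y : MalcevNeumann R M) :
    (x - y).supp ⊆ x.supp ∪ y.supp := Function.support_sub _ _

theorem supp_single [Zero R] (g : M) (a : R) : (single g a).supp ⊆ {g} := fun k hk => by
  by_contra hne
  exact hk (coeff_single_of_ne a hne)

end Projection

/-! ### Leading exponents and their multiplicativity. -/

section Leading

variable {R M : Type*} [LinearOrder M]

/-- `g` is the first exponent that occurs in `x`. -/
def IsLead [Zero R] (x : MalcevNeumann R M) (g : M) : Prop :=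
  x.coeff g ≠ 0 ∧ x.supp ⊆ Set.Ici g

theorem exists_isLead [AddCommGroup R] {x : MalcevNeumann R M} (hx : x ≠ 0) :
    ∃ g, IsLead x g := by
  have hne : x.supp.Nonempty := by
    by_contra hn
    refine hx (MalcevNeumann.ext (funext fun g => ?_))
    by_contra hg
    exact hn ⟨g, hg⟩
  exact ⟨x.isWF_support.min hne, x.isWF_support.min_mem hne,
    fun k hk => x.isWF_support.min_le hne hk⟩

theorem IsLead.unique [Zero R] {x : MalcevNeumann R M} {g h : M} (hg : IsLead x g)
    (hh : IsLead x h) : g = h :=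
  le_antisymm (hg.2 hh.1) (hh.2 hg.1)

variable [Monoid M] [MulLeftStrictMono M] [MulRightStrictMono M] [Ring R]

theorem supp_mul_subset_Ici {x y : MalcevNeumann R M} {g h : M} (hx : x.supp ⊆ Set.Ici g)
    (hy : y.supp ⊆ Set.Ici h) : (x * y).supp ⊆ Set.Ici (g * h) := by
  intro k hk
  obtain ⟨a, ha, b, hb, rfl⟩ := supp_mul x y hk
  exact ((strictMono_mul_right h).monotone (hx ha)).trans
    ((strictMono_mul_left a).monotone (hy hb))

theorem supp_mul_subset_Ioi_of_left {x y : MalcevNeumann R M} {g h : M}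
    (hx : x.supp ⊆ Set.Ioi g) (hy : y.supp ⊆ Set.Ici h) : (x * y).supp ⊆ Set.Ioi (g * h) := by
  intro k hk
  obtain ⟨a, ha, b, hb, rfl⟩ := supp_mul x y hk
  exact (strictMono_mul_right h (hx ha)).trans_le ((strictMono_mul_left a).monotone (hy hb))

theorem supp_mul_subset_Ioi_of_right {x y : MalcevNeumann R M} {g h : M}
    (hx : x.supp ⊆ Set.Ici g) (hy : y.supp ⊆ Set.Ioi h) : (x * y).supp ⊆ Set.Ioi (g * h) := by
  intro k hk
  obtain ⟨a, ha, b, hb, rfl⟩ := supp_mul x y hk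
  exact ((strictMono_mul_right h).monotone (hx ha)).trans_lt (strictMono_mul_left a (hy hb))

theorem IsLead.mul [NoZeroDivisors R] {x y : MalcevNeumann R M} {g h : M} (hx : IsLead x g)
    (hy : IsLead y h) : IsLead (x * y) (g * h) := by
  refine ⟨?_, supp_mul_subset_Ici hx.2 hy.2⟩
  rw [coeff_mul, Finset.sum_eq_single (g, h)]
  · exact mul_ne_zero hx.1 hy.1
  · rintro ⟨p, q⟩ hp hne
    obtain ⟨h1, h2, h3⟩ := mem_pairs.1 hp
    exfalso
    have h5 : p * h ≤ p * q := (strictMono_mul_left p).monotone (hy.2 h2)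
    rcases (hx.2 h1 : g ≤ p).lt_or_eq with h4 | rfl
    · have h4 : g * h < p * h := strictMono_mul_right h h4
      exact absurd h3 (h4.trans_le h5).ne'
    · exact hne (congrArg (Prod.mk g) ((strictMono_mul_left g).injective h3))
  · exact fun hn => (hn (mem_pairs.2 ⟨hx.1, hy.1, rfl⟩)).elim

end Leading

/-! ### Fixed points of contracting maps on series. -/

section FixedPoint

variable {R M : Type*} [LinearOrder M] [AddCommGroup R]

/-- A strictly contracting self-map of the formal sums supported in `S` has a fixed point. -/
theorem exists_fixedPoint (S : Set M) (F : MalcevNeumann R M → MalcevNeumann R M)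
    (hF : ∀ x, x.supp ⊆ S → (F x).supp ⊆ S)
    (hcontr : ∀ x y, x.supp ⊆ S → y.supp ⊆ S → ∀ g, (∀ k < g, x.coeff k = y.coeff k) →
      (F x).coeff g = (F y).coeff g) :
    ∃ x, x.supp ⊆ S ∧ F x = x := by
  classical
  -- The exponents are not well-ordered, so the coefficients cannot be defined by recursion on them.
  -- Instead, solutions that are correct on a lower set `I` are glued.
  let Good : MalcevNeumann R M → Set M → Prop := fun x I =>
    IsLowerSet I ∧ x.supp ⊆ S ∧ ∀ g ∈ I, (F x).coeff g = x.coeff g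
  -- At the first exponent of `I ∩ J` where two partial solutions differ they agree on everything
  -- below, so contraction makes them agree there too.
  have huniq : ∀ x I y J, Good x I → Good y J → ∀ g, g ∈ I → g ∈ J → x.coeff g = y.coeff g := by
    intro x I y J hx hy
    have hwf : (x - y).supp.IsWF := (x - y).isWF_support
    intro g hgI hgJ
    by_contra hne
    have hne' : ((x - y).supp ∩ (I ∩ J)).Nonempty := ⟨g, sub_ne_zero.2 hne, hgI, hgJ⟩
    have hwf' := hwf.mono (Set.inter_subset_left (t := I ∩ J))
    obtain ⟨hk, hkI, hkJ⟩ := hwf'.min_mem hne'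
    refine hk (sub_eq_zero.2 ?_)
    rw [← hx.2.2 _ hkI, ← hy.2.2 _ hkJ]
    refine hcontr x y hx.2.1 hy.2.1 _ fun l hl => ?_
    by_contra hl'
    exact absurd (hwf'.min_le hne' ⟨sub_ne_zero.2 hl', hx.1 hl.le hkI, hy.1 hl.le hkJ⟩)
      (not_le_of_gt hl)
  let c : M → R := fun g => if h : ∃ x I, Good x I ∧ g ∈ I then h.choose.coeff g else 0
  have hc : ∀ x I g, Good x I → g ∈ I → c g = x.coeff g := by
    intro x I g hx hg
    have h : ∃ x I, Good x I ∧ g ∈ I := ⟨x, I, hx, hg⟩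
    have h1 : c g = h.choose.coeff g := dif_pos h
    rw [h1]
    obtain ⟨J, hJ, hgJ⟩ := h.choose_spec
    exact huniq _ J _ I hJ hx g hgJ hg
  have hc0 : ∀ g, c g ≠ 0 → ∃ x I, Good x I ∧ g ∈ I := fun g hg => by
    by_contra h
    exact hg (dif_neg h)
  -- A descending sequence stays in the lower set that contains its first term, and there `c`
  -- coincides with a single series.
  have hwf : (Function.support c).IsWF := by
    rw [Set.isWF_iff_no_descending_seq]
    intro f hf hsub
    obtain ⟨x, I, hx, hI⟩ := hc0 _ (hsub 0)
    have hfI : ∀ n, f n ∈ I := fun n => hx.1 (hf.antitone (Nat.zero_le n)) hI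
    refine Set.isWF_iff_no_descending_seq.1 x.isWF_support f hf fun n => ?_
    have h1 : c (f n) ≠ 0 := hsub n
    rwa [hc x I _ hx (hfI n)] at h1
  let y : MalcevNeumann R M := ⟨c, hwf⟩
  have hyS : y.supp ⊆ S := fun g hg => by
    obtain ⟨x, I, hx, hgI⟩ := hc0 g hg
    refine hx.2.1 ?_
    rw [mem_supp, ← hc x I g hx hgI]
    exact hg
  have hfix : ∀ x I, Good x I → ∀ g ∈ I, (F y).coeff g = y.coeff g := by
    intro x I hx g hg
    rw [show y.coeff g = x.coeff g from hc x I g hx hg, ← hx.2.2 g hg]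
    exact hcontr y x hyS hx.2.1 g fun k hk => hc x I k hx (hx.1 hk.le hg)
  refine ⟨y, hyS, ?_⟩
  by_contra hne
  obtain ⟨k, hk, hlow⟩ := exists_isLead (sub_ne_zero.2 hne)
  have hlow' : ∀ l < k, (F y).coeff l = y.coeff l := fun l hl => by
    by_contra h
    exact absurd (hlow (sub_ne_zero.2 h : (F y - y).coeff l ≠ 0)) (not_le_of_gt hl)
  -- If `F y` and `y` first differ at `k`, truncating `F y` after `k` gives a partial solution that
  -- reaches `k`; but `y` is already fixed wherever some partial solution is defined.
  let z := proj (Set.Iic k) (F y)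
  have hzS : z.supp ⊆ S := fun g hg => hF y hyS (supp_proj _ _ hg).2
  have hz : Good z (Set.Iic k) := by
    refine ⟨isLowerSet_Iic k, hzS, fun g hg => ?_⟩
    rw [coeff_proj_of_mem _ hg]
    refine hcontr z y hzS hyS g fun l hl => ?_
    have hlk : l < k := lt_of_lt_of_le hl hg
    rw [coeff_proj_of_mem _ (Set.mem_Iic.2 hlk.le), hlow' l hlk]
  exact hk (sub_eq_zero.2 (hfix z _ hz k (Set.mem_Iic.2 le_rfl)))

end FixedPoint

/-! ### Projection to a subgroup as a bimodule map. -/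

section Group

variable {R G : Type*} [Ring R] [Group G] [LinearOrder G] [MulLeftStrictMono G]
  [MulRightStrictMono G]

theorem coeff_single_mul (g : G) (r : R) (x : MalcevNeumann R G) (h : G) :
    (single g r * x).coeff h = r * x.coeff (g⁻¹ * h) := by
  simpa using single_mul_coeff g r x (g⁻¹ * h)

theorem coeff_mul_single (g : G) (r : R) (x : MalcevNeumann R G) (h : G) :
    (x * single g r).coeff h = x.coeff (h * g⁻¹) * r := by
  simpa using mul_single_coeff g r x (h * g⁻¹)

theorem supp_mul_subset_subgroup {C : Subgroup G} {x y : MalcevNeumann R G}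
    (hx : x.supp ⊆ C) (hy : y.supp ⊆ C) : (x * y).supp ⊆ C := by
  intro k hk
  obtain ⟨a, ha, b, hb, rfl⟩ := supp_mul x y hk
  exact C.mul_mem (hx ha) (hy hb)

/-- Multiplication by an element of `C` preserves both `C` and its complement, so the part of `y`
outside `C` contributes nothing to the projection. -/
theorem proj_mul_left (C : Subgroup G) {x : MalcevNeumann R G} (hx : x.supp ⊆ C)
    (y : MalcevNeumann R G) : proj (C : Set G) (x * y) = x * proj (C : Set G) y := by
  have h : x * y = x * proj (C : Set G) y + x * (y - proj (C : Set G) y) := by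
    rw [← mul_add, add_sub_cancel]
  rw [h, proj_add, proj_eq_self (supp_mul_subset_subgroup hx
    ((supp_proj _ _).trans Set.inter_subset_left)), add_eq_left]
  refine proj_eq_zero ?_
  intro g hg
  by_contra hne
  obtain ⟨a, ha, b, hb, rfl⟩ := supp_mul _ _ hne
  refine hb ?_
  rw [coeff_sub, coeff_proj_of_mem, sub_self]
  exact (C.mul_mem_cancel_left (hx ha)).1 hg

theorem proj_mul_right (C : Subgroup G) (x : MalcevNeumann R G) {y : MalcevNeumann R G}
    (hy : y.supp ⊆ C) : proj (C : Set G) (x * y) = proj (C : Set G) x * y := by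
  have h : x * y = proj (C : Set G) x * y + (x - proj (C : Set G) x) * y := by
    rw [← add_mul, add_sub_cancel]
  rw [h, proj_add, proj_eq_self (supp_mul_subset_subgroup
    ((supp_proj _ _).trans Set.inter_subset_left) hy), add_eq_left]
  refine proj_eq_zero ?_
  intro g hg
  by_contra hne
  obtain ⟨a, ha, b, hb, rfl⟩ := supp_mul _ _ hne
  refine ha ?_
  rw [coeff_sub, coeff_proj_of_mem, sub_self]
  exact (C.mul_mem_cancel_right (hy hb)).1 hg

end Group

end MalcevNeumann

/-! ### Centralizers in free groups. -/

namespace FreeGroup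

variable {Y : Type*}

/-- Two non-commuting transpositions of three points separate the products. -/
theorem of_mul_of_ne {x y : Y} (h : x ≠ y) : of x * of y ≠ of y * of x := by
  classical
  intro hc
  have := congrArg (lift fun i => if i = x then Equiv.swap (0 : Fin 3) 1 else Equiv.swap 1 2) hc
  simp only [_root_.map_mul, lift_apply_of, if_true, if_neg h.symm] at this
  exact absurd this (by decide)

end FreeGroup

namespace IsFreeGroup

variable {H : Type*} [Group H] [IsFreeGroup H]

theorem isCyclic_of_subsingleton_generators [Subsingleton (Generators H)] : IsCyclic H := by
  have : IsCyclic (FreeGroup (Generators H)) := by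
    rcases isEmpty_or_nonempty (Generators H) with h | ⟨⟨x⟩⟩
    · infer_instance
    · have : Unique (Generators H) := ⟨⟨x⟩, fun _ => Subsingleton.elim _ _⟩
      infer_instance
  exact isCyclic_of_surjective (toFreeGroup H).symm (toFreeGroup H).symm.surjective

theorem isCyclic_of_mul_comm (hH : ∀ a b : H, a * b = b * a) : IsCyclic H := by
  have : Subsingleton (Generators H) := ⟨fun x y => by
    by_contra h
    refine FreeGroup.of_mul_of_ne h ((toFreeGroup H).symm.injective ?_)
    rw [map_mul, map_mul, hH]⟩
  exact isCyclic_of_subsingleton_generators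

end IsFreeGroup

namespace FreeGroup

variable {Y : Type*}

/-- By Nielsen–Schreier the abelian subgroup generated by `w` and `x` is free, hence cyclic. A
generator `x` is not a proper power, because its total exponent is 1, so it generates this subgroup.
-/
theorem mem_zpowers_of_commute_of {x : Y} {w : FreeGroup Y} (h : w * of x = of x * w) :
    w ∈ Subgroup.zpowers (of x) := by
  let H := Subgroup.closure {w, of x}
  have hcomm : ∀ a b : H, a * b = b * a := by
    have : IsMulCommutative H := Subgroup.isMulCommutative_closure (by
      rintro a (rfl | rfl) b (rfl | rfl) <;> simp [h])
    exact fun a b => mul_comm' a b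
  obtain ⟨⟨c, hcH⟩, hc⟩ := (IsFreeGroup.isCyclic_of_mul_comm hcomm).exists_generator
  have hpow : ∀ a ∈ H, a ∈ Subgroup.zpowers c := fun a ha => by
    obtain ⟨n, hn⟩ := hc ⟨a, ha⟩
    exact ⟨n, congrArg Subtype.val hn⟩
  obtain ⟨i, hi⟩ := hpow (of x) (Subgroup.subset_closure (by simp))
  have hw := hpow w (Subgroup.subset_closure (by simp))
  let f : FreeGroup Y →* Multiplicative ℤ := lift fun _ => Multiplicative.ofAdd 1
  have hf : i * (f c).toAdd = 1 := by
    have := congrArg (fun a => (f a).toAdd) hi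
    simpa [f] using this
  refine (Subgroup.zpowers_le.2 ?_) hw
  rcases Int.isUnit_iff.1 (IsUnit.of_mul_eq_one _ hf) with rfl | rfl
  · exact ⟨1, by simpa using hi.symm⟩
  · exact ⟨-1, by simp [← hi]⟩

theorem eq_one_of_commute_of_of {x y : Y} (hxy : x ≠ y) {w : FreeGroup Y}
    (hx : w * of x = of x * w) (hy : w * of y = of y * w) : w = 1 := by
  classical
  obtain ⟨i, rfl⟩ := mem_zpowers_of_commute_of hx
  obtain ⟨j, hj⟩ := mem_zpowers_of_commute_of hy
  have := congrArg (fun a => (lift (fun k => Multiplicative.ofAdd (if k = x then (1 : ℤ) else 0))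
    a).toAdd) hj
  have hi : i = 0 := by simpa [hxy.symm] using this.symm
  simp [hi]

theorem eq_one_of_forall_commute [Nontrivial Y] (g : FreeGroup Y) (hg : ∀ h, g * h = h * g) :
    g = 1 := by
  obtain ⟨x, y, hxy⟩ := exists_pair_ne Y
  exact eq_one_of_commute_of_of hxy (hg _) (hg _)

/-- The centralizer is free by Nielsen–Schreier and has the nontrivial central element `g`. A free
group on two or more generators has trivial center, so at most one generator remains. -/
theorem isCyclic_centralizer {g : FreeGroup Y} (hg : g ≠ 1) :
    IsCyclic (Subgroup.centralizer {g}) := by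
  let H := Subgroup.centralizer {g}
  have hgH : ∀ h ∈ H, g * h = h * g := fun h hh =>
    (Subgroup.mem_centralizer_singleton_iff.1 hh).symm
  let w : H := ⟨g, Subgroup.mem_centralizer_singleton_iff.2 rfl⟩
  let e := IsFreeGroup.toFreeGroup H
  have hs : Subsingleton (IsFreeGroup.Generators H) := ⟨fun x y => by
    by_contra h
    have hcomm : ∀ a, e w * a = a * e w := fun a => by
      obtain ⟨a, rfl⟩ := e.surjective a
      rw [← _root_.map_mul, ← _root_.map_mul]
      exact congrArg e (Subtype.ext (hgH a a.2))
    have h1 := eq_one_of_commute_of_of h (hcomm _) (hcomm _)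
    exact hg (congrArg Subtype.val ((MulEquiv.map_eq_one_iff e).1 h1))⟩
  exact IsFreeGroup.isCyclic_of_subsingleton_generators

theorem commute_of_commute {g a b : FreeGroup Y} (hg : g ≠ 1) (ha : Commute a g)
    (hb : Commute b g) : Commute a b := by
  obtain ⟨c, hc⟩ := (isCyclic_centralizer hg).exists_generator
  obtain ⟨m, hm⟩ := hc ⟨a, Subgroup.mem_centralizer_singleton_iff.2 ha⟩
  obtain ⟨n, hn⟩ := hc ⟨b, Subgroup.mem_centralizer_singleton_iff.2 hb⟩
  have hm' : (c : FreeGroup Y) ^ m = a := congrArg Subtype.val hm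
  have hn' : (c : FreeGroup Y) ^ n = b := congrArg Subtype.val hn
  rw [← hm', ← hn']
  exact Commute.zpow_zpow_self _ m n

/-- In a free group with a bi-invariant order, an element that conjugates `g` into the centralizer
of `g` commutes with `g`. -/
theorem commute_of_conj_commute [LinearOrder (FreeGroup Y)] [MulLeftStrictMono (FreeGroup Y)]
    [MulRightStrictMono (FreeGroup Y)] {g h : FreeGroup Y} (hgh : Commute (h * g * h⁻¹) g) :
    Commute h g := by
  rcases eq_or_ne g 1 with rfl | hg
  · exact Commute.one_right h
  have hg' : h * g * h⁻¹ ≠ 1 := fun h1 => hg (conj_eq_one_iff.1 h1)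
  obtain ⟨⟨z, hzC⟩, hz⟩ := (isCyclic_centralizer hg).exists_generator
  have hpow : ∀ a, Commute a g → ∃ n : ℤ, z ^ n = a := fun a ha => by
    obtain ⟨n, hn⟩ := hz ⟨a, Subgroup.mem_centralizer_singleton_iff.2 ha⟩
    exact ⟨n, congrArg Subtype.val hn⟩
  have hzg : Commute z g := Subgroup.mem_centralizer_singleton_iff.1 hzC
  obtain ⟨n, hn⟩ := hpow g (Commute.refl g)
  have hz1 : z ≠ 1 := by
    rintro rfl
    exact hg (by rw [← hn, one_zpow])
  have hconj : Commute (h * z * h⁻¹) (h * g * h⁻¹) := hzg.conj h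
  -- Commuting is transitive through nontrivial elements, so `g` and `h g h⁻¹` have the same
  -- centralizer, and conjugation by `h` or `h⁻¹` maps its generator `z` to a power of `z`.
  obtain ⟨i, hi⟩ := hpow (h * z * h⁻¹) (commute_of_commute hg' hconj hgh.symm)
  obtain ⟨j, hj⟩ : ∃ j : ℤ, z ^ j = h⁻¹ * z * h := by
    refine hpow _ ?_
    have h1 : Commute z (h * g * h⁻¹) := commute_of_commute hg hzg hgh
    have h2 := h1.conj h⁻¹
    simpa [mul_assoc] using h2
  have hij : z ^ (i * j) = z ^ (1 : ℤ) := by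
    rw [zpow_mul, hi, conj_zpow, hj, zpow_one]
    group
  have hij' : i * j = 1 := by
    have hz0 : z ^ (i * j - 1) = 1 := by rw [zpow_sub, hij, mul_inv_cancel]
    have := (IsMulTorsionFree.zpow_eq_one_iff_right hz1).1 hz0
    omega
  -- The exponent is a unit of `ℤ`, and `-1` is excluded because conjugation preserves the side of 1
  -- on which `z` lies. This is where the order is needed.
  have hi1 : i = 1 := by
    rcases Int.isUnit_iff.1 (IsUnit.of_mul_eq_one _ hij') with h1 | h1
    · exact h1
    · exfalso
      rw [h1, zpow_neg_one] at hi
      rcases lt_or_gt_of_ne hz1 with h2 | h2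
      · have h3 : h * z * h⁻¹ < 1 := by
          simpa using MalcevNeumann.strictMono_mul_right h⁻¹ (MalcevNeumann.strictMono_mul_left h h2)
        rw [← hi] at h3
        exact absurd h2 (not_lt_of_gt (inv_lt_one'.1 h3))
      · have h3 : 1 < h * z * h⁻¹ := by
          simpa using MalcevNeumann.strictMono_mul_right h⁻¹ (MalcevNeumann.strictMono_mul_left h h2)
        rw [← hi] at h3
        exact absurd h2 (not_lt_of_gt (one_lt_inv'.1 h3))
  have hhz : Commute h z := by
    rw [hi1, zpow_one] at hi
    exact (eq_mul_inv_iff_mul_eq.1 hi).symm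
  rw [← hn]
  exact hhz.zpow_right n

end FreeGroup

namespace MalcevNeumann

/-! ### Conjugating a series into the centralizer of its leading exponent. -/

section Conjugation

variable {R G : Type*} [Ring R] [Group G] [LinearOrder G] [MulLeftStrictMono G]
  [MulRightStrictMono G]

/-- An element with leading term `g` is conjugate to an element that is supported in the
centralizer of `g`. -/
theorem exists_conj_supp_subset_centralizer (g : G) {s : MalcevNeumann R G}
    (hs : s.supp ⊆ Set.Ioi g) :
    ∃ x p : MalcevNeumann R G, x.coeff 1 = 1 ∧ p.supp ⊆ Subgroup.centralizer {g} ∧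
      p.supp ⊆ Set.Ioi g ∧ (single g 1 + s) * x = x * (single g 1 + p) := by
  set C := Subgroup.centralizer {g} with hC
  have hCmem : ∀ {h}, h ∈ C ↔ h * g = g * h := Subgroup.mem_centralizer_singleton_iff
  -- Put `x = 1 + u` with `u` supported off `C`. The equation `(g + s)(1 + u) = (1 + u)(g + p)`
  -- becomes `g u - u g = u p - (s (1 + u) - p)`. Its `C`-part dictates `p`, and `r` below is the
  -- right-hand side. `P` and `N` split the complement of `C`. Comparing coefficients at `g k` for
  -- `k ∈ P`, and at `k g` for `k ∈ N`, expresses `u` at `k` through `u` at a conjugate of `k`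
  -- smaller than `k` and through `r`. This is the equation `F u = u`.
  let P : Set G := {h | g * h < h * g}
  let N : Set G := {h | h * g < g * h}
  let c : MalcevNeumann R G := single g 1
  let c' : MalcevNeumann R G := single g⁻¹ 1
  let p : MalcevNeumann R G → MalcevNeumann R G := fun u => proj (C : Set G) (s * (1 + u))
  let r : MalcevNeumann R G → MalcevNeumann R G := fun u => u * p u - (s * (1 + u) - p u)
  let F : MalcevNeumann R G → MalcevNeumann R G := fun u =>
    proj P (c' * (u * c + r u)) + proj N ((c * u - r u) * c')
  have hFP : ∀ u, ∀ k ∈ P, (F u).coeff k = u.coeff (g * k * g⁻¹) + (r u).coeff (g * k) := by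
    intro u k hk
    have hkN : k ∉ N := fun h : k * g < g * k => lt_asymm h hk
    simp [F, c, c', coeff_proj_of_mem _ hk, coeff_proj_of_notMem _ hkN, coeff_single_mul,
      coeff_mul_single]
  have hFN : ∀ u, ∀ k ∈ N, (F u).coeff k = u.coeff (g⁻¹ * (k * g)) - (r u).coeff (k * g) := by
    intro u k hk
    have hkP : k ∉ P := fun h : g * k < k * g => lt_asymm h hk
    simp [F, c, c', coeff_proj_of_mem _ hk, coeff_proj_of_notMem _ hkP, coeff_single_mul,
      coeff_mul_single]
  have hF0 : ∀ u, ∀ k ∈ C, (F u).coeff k = 0 := by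
    intro u k hk
    rw [hCmem] at hk
    have hkP : k ∉ P := fun h : g * k < k * g => h.ne' hk
    have hkN : k ∉ N := fun h : k * g < g * k => h.ne hk
    simp [F, coeff_proj_of_notMem _ hkP, coeff_proj_of_notMem _ hkN]
  have hone : (1 : MalcevNeumann R G).supp ⊆ Set.Ici 1 :=
    (supp_single 1 1).trans (by simp)
  have hsu : ∀ u : MalcevNeumann R G, u.supp ⊆ Set.Ici 1 → (s * (1 + u)).supp ⊆ Set.Ioi g :=
    fun u hu => by
      simpa using supp_mul_subset_Ioi_of_left hs (supp_add_subset hone hu)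
  have hpg : ∀ u, u.supp ⊆ Set.Ici 1 → (p u).supp ⊆ Set.Ioi g := fun u hu =>
    ((supp_proj _ _).trans Set.inter_subset_right).trans (hsu u hu)
  have hpC : ∀ u, (p u).supp ⊆ C := fun u => (supp_proj _ _).trans Set.inter_subset_left
  have hrg : ∀ u, u.supp ⊆ Set.Ici 1 → (r u).supp ⊆ Set.Ioi g := fun u hu => by
    refine (supp_sub _ _).trans (Set.union_subset ?_ ((supp_sub _ _).trans
      (Set.union_subset (hsu u hu) (hpg u hu))))
    simpa using supp_mul_subset_Ioi_of_right hu (hpg u hu)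
  -- Both bounds on `e` are needed: a change of `u` from `k` onwards affects `u p` through the left
  -- factor only beyond `k g`, and the remaining terms only beyond `g k`. At `k`, the map `F` reads
  -- `r` at the smaller of these two exponents.
  have hrdiff : ∀ u w, u.supp ⊆ Set.Ici 1 → w.supp ⊆ Set.Ici 1 → ∀ k,
      (∀ l < k, u.coeff l = w.coeff l) → ∀ e, e ≤ g * k → e ≤ k * g →
      (r u).coeff e = (r w).coeff e := by
    intro u w hu hw k hk e he1 he2
    have hd : (u - w).supp ⊆ Set.Ici k := fun l hl => by
      by_contra hlk
      exact hl (sub_eq_zero.2 (hk l (not_le.1 hlk)))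
    have hsd : (s * (u - w)).supp ⊆ Set.Ioi (g * k) := supp_mul_subset_Ioi_of_left hs hd
    have hpd : p u - p w = proj (C : Set G) (s * (u - w)) := by
      rw [← proj_sub]
      congr 1
      noncomm_ring
    have hpd' : (p u - p w).supp ⊆ Set.Ioi (g * k) := by
      rw [hpd]
      exact ((supp_proj _ _).trans Set.inter_subset_right).trans hsd
    have hr : r u - r w = (u - w) * p u + w * (p u - p w) + (p u - p w) - s * (u - w) := by
      simp only [r]
      noncomm_ring
    have h1 : ((u - w) * p u).coeff e = 0 := by
      by_contra h
      exact absurd (supp_mul_subset_Ioi_of_right hd (hpg u hu) h) (not_lt_of_ge he2)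
    have h2 : (w * (p u - p w)).coeff e = 0 := by
      by_contra h
      have := supp_mul_subset_Ioi_of_right hw hpd' h
      rw [one_mul] at this
      exact absurd this (not_lt_of_ge he1)
    have h3 : (p u - p w).coeff e = 0 := by
      by_contra h
      exact absurd (hpd' h) (not_lt_of_ge he1)
    have h4 : (s * (u - w)).coeff e = 0 := by
      by_contra h
      exact absurd (hsd h) (not_lt_of_ge he1)
    rw [← sub_eq_zero, ← coeff_sub, hr, coeff_sub, coeff_add, coeff_add, h1, h2, h3, h4]
    simp
  have hconjP : ∀ k ∈ P, g * k * g⁻¹ < k := fun k hk => by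
    have := strictMono_mul_right g⁻¹ hk
    simpa using this
  have hconjN : ∀ k ∈ N, g⁻¹ * (k * g) < k := fun k hk => by
    have := strictMono_mul_left g⁻¹ hk
    simpa using this
  have hcases : ∀ k, k ∈ P ∨ k ∈ N ∨ k ∈ C := fun k => by
    rcases lt_trichotomy (g * k) (k * g) with h | h | h
    · exact Or.inl h
    · exact Or.inr (Or.inr (hCmem.2 h.symm))
    · exact Or.inr (Or.inl h)
  obtain ⟨u, hu, hfix⟩ := exists_fixedPoint (Set.Ici 1) F
    (fun u hu k hk => by
      by_contra hlt
      replace hlt : k < 1 := not_le.1 hlt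
      have hu0 : ∀ l < 1, u.coeff l = 0 := fun l hl => by
        by_contra h
        exact absurd (hu h) (not_le_of_gt hl)
      have hr0 : ∀ l < g, (r u).coeff l = 0 := fun l hl => by
        by_contra h
        exact lt_asymm (hrg u hu h) hl
      refine hk ?_
      rcases hcases k with h | h | h
      · rw [hFP u k h, hu0 _ ((hconjP k h).trans hlt), hr0, add_zero]
        simpa using strictMono_mul_left g hlt
      · rw [hFN u k h, hu0 _ ((hconjN k h).trans hlt), hr0, sub_zero]
        simpa using strictMono_mul_right g hlt
      · exact hF0 u k h)
    (fun u w hu hw k hk => by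
      rcases hcases k with h | h | h
      · rw [hFP u k h, hFP w k h, hk _ (hconjP k h),
          hrdiff u w hu hw k hk (g * k) le_rfl (le_of_lt h)]
      · rw [hFN u k h, hFN w k h, hk _ (hconjN k h),
          hrdiff u w hu hw k hk (k * g) (le_of_lt h) le_rfl]
      · rw [hF0 u k h, hF0 w k h])
  have hu0 : proj (C : Set G) u = 0 := proj_eq_zero fun k hk => by rw [← hfix, hF0 u k hk]
  have hcC : c.supp ⊆ C := (supp_single g 1).trans (by simp [hCmem])
  have hr0 : proj (C : Set G) (r u) = 0 := by
    rw [proj_sub, proj_sub, proj_mul_right C u (hpC u), hu0, zero_mul, proj_eq_self (hpC u),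
      sub_self, sub_self]
  -- Off `C` this is the fixed-point equation, translated by `g`; on `C` all three terms vanish.
  have hmain : c * u = u * c + r u := by
    ext k
    rw [coeff_add, coeff_single_mul, coeff_mul_single, one_mul, mul_one]
    rcases hcases k with h | h | h
    · have hk : g⁻¹ * k ∈ P := by
        have := strictMono_mul_left g⁻¹ (h : g * k < k * g)
        simpa [P, mul_assoc] using this
      have := hFP u _ hk
      rw [hfix] at this
      simpa using this
    · have hk : k * g⁻¹ ∈ N := by
        have := strictMono_mul_right g⁻¹ (h : k * g < g * k)
        simpa [N, mul_assoc] using this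
      have := hFN u _ hk
      rw [hfix] at this
      simp only [inv_mul_cancel_right] at this
      rw [this, sub_add_cancel]
    · have hz : ∀ l ∈ C, u.coeff l = 0 := fun l hl => by
        rw [← coeff_proj_of_mem u (S := (C : Set G)) hl, hu0, coeff_zero]
      have hg : g ∈ C := hCmem.2 rfl
      rw [hz _ (C.mul_mem (C.inv_mem hg) h), hz _ (C.mul_mem h (C.inv_mem hg)), zero_add,
        ← coeff_proj_of_mem (r u) (S := (C : Set G)) h, hr0, coeff_zero]
  refine ⟨1 + u, p u, ?_, hpC u, hpg u hu, ?_⟩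
  · rw [coeff_add, coeff_one_one, ← hfix, hF0 u 1 C.one_mem, add_zero]
  · calc (c + s) * (1 + u) = c + c * u + s * (1 + u) := by noncomm_ring
      _ = (1 + u) * (c + p u) := by
        rw [hmain]
        simp only [r]
        noncomm_ring

end Conjugation

end MalcevNeumann

namespace MalcevNeumann

/-! ### Commutation of series, and the center. -/

section Centralizers

variable {R G : Type*} [Group G] [LinearOrder G] [MulLeftStrictMono G] [MulRightStrictMono G]

theorem mul_comm_of_supp_subset [CommRing R] {C : Set G}
    (hC : ∀ a ∈ C, ∀ b ∈ C, a * b = b * a) {x y : MalcevNeumann R G} (hx : x.supp ⊆ C)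
    (hy : y.supp ⊆ C) : x * y = y * x := by
  ext a
  rw [coeff_mul, coeff_mul]
  refine Finset.sum_nbij' Prod.swap Prod.swap ?_ ?_ (fun _ _ => rfl) (fun _ _ => rfl)
    (fun _ _ => mul_comm _ _)
  · rintro ⟨b, c⟩ h
    obtain ⟨hb, hc, h⟩ := mem_pairs.1 h
    exact mem_pairs.2 ⟨hc, hb, (hC _ (hy hc) _ (hx hb)).trans h⟩
  · rintro ⟨b, c⟩ h
    obtain ⟨hb, hc, h⟩ := mem_pairs.1 h
    exact mem_pairs.2 ⟨hc, hb, (hC _ (hy hb) _ (hx hc)).symm.trans h⟩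

/-- An element that commutes with an element supported in the centralizer of its leading exponent
is itself supported there. -/
theorem supp_subset_centralizer_of_commute [Ring R] [NoZeroDivisors R] {g : G}
    {x y : MalcevNeumann R G} (hlead : IsLead x g) (hx : x.supp ⊆ Subgroup.centralizer {g})
    (hxy : y * x = x * y) : y.supp ⊆ Subgroup.centralizer {g} := by
  set C := Subgroup.centralizer {g}
  set z := y - proj (C : Set G) y with hz
  have hzC : ∀ k ∈ C, z.coeff k = 0 := fun k hk => by
    rw [hz, coeff_sub, coeff_proj_of_mem _ hk, sub_self]
  have hz0 : z = 0 := by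
    by_contra hne
    obtain ⟨h, hh⟩ := exists_isLead hne
    -- The part of `y` outside `C` still commutes with `x`, since projecting respects multiplication
    -- by `x`. Comparing leading exponents then puts its leading exponent into `C`, a contradiction.
    have hcomm : z * x = x * z := by
      rw [hz, sub_mul, mul_sub, ← proj_mul_left C hx, ← proj_mul_right C y hx, hxy]
    have h1 := hh.mul hlead
    rw [hcomm] at h1
    exact hh.1 (hzC h (Subgroup.mem_centralizer_singleton_iff.2 (h1.unique (hlead.mul hh))))
  rw [sub_eq_zero.1 hz0]
  exact (supp_proj _ _).trans Set.inter_subset_left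

theorem single_one_mem_center [CommRing R] (a : R) :
    (single 1 a : MalcevNeumann R G) ∈ Set.center (MalcevNeumann R G) := by
  rw [Semigroup.mem_center_iff]
  intro x
  ext g
  rw [coeff_mul_single, coeff_single_mul, inv_one, mul_one, one_mul, mul_comm]

/-- A central element is a constant if the group has trivial center. -/
theorem eq_single_one_of_mem_center [CommRing R] [IsDomain R]
    (hG : ∀ g : G, (∀ h, g * h = h * g) → g = 1) {x : MalcevNeumann R G}
    (hx : x ∈ Set.center (MalcevNeumann R G)) : x = single 1 (x.coeff 1) := by
  by_contra hne
  obtain ⟨g, hg⟩ := exists_isLead (sub_ne_zero.2 hne)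
  -- Without its constant term, `x` is still central. Testing against monomials makes its leading
  -- exponent central in `G`, hence 1, where the coefficient has been removed.
  have hcomm : ∀ y, (x - single 1 (x.coeff 1)) * y = y * (x - single 1 (x.coeff 1)) := fun y => by
    rw [sub_mul, mul_sub, Semigroup.mem_center_iff.1 hx y,
      Semigroup.mem_center_iff.1 (single_one_mem_center (x.coeff 1)) y]
  have hg1 : g = 1 := hG g fun h => by
    have hh : IsLead (single h (1 : R)) h := ⟨by simp, (supp_single h 1).trans (by simp)⟩
    have := hg.mul hh
    rw [hcomm] at this
    exact this.unique (hh.mul hg)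
  subst hg1
  exact hg.1 (by simp)

end Centralizers

/-! ### The division ring of a free group. -/

section Free

variable {Δ X : Type*} [Field Δ] [LinearOrder (FreeGroup X)] [MulLeftStrictMono (FreeGroup X)]
  [MulRightStrictMono (FreeGroup X)]

local notation "D" => MalcevNeumann Δ (FreeGroup X)

theorem single_of_mul_ne {x y : X} (h : x ≠ y) :
    (single (FreeGroup.of x) 1 * single (FreeGroup.of y) 1 : D) ≠
      single (FreeGroup.of y) 1 * single (FreeGroup.of x) 1 := by
  intro heq
  have h1 := congrArg (fun z : D => z.coeff (FreeGroup.of x * FreeGroup.of y)) heq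
  have hne : (FreeGroup.of y)⁻¹ * (FreeGroup.of x * FreeGroup.of y) ≠ FreeGroup.of x :=
    fun h2 => FreeGroup.of_mul_of_ne h (inv_mul_eq_iff_eq_mul.1 h2)
  simp [coeff_single_mul, coeff_single_of_ne _ hne] at h1

/-- The center consists of constants, so a relation between powers of one generator can be read off
coefficient by coefficient; these powers are distinct because the free group is torsion-free. -/
theorem not_finite_over_center [Nontrivial X] : ¬ Module.Finite (Subring.center D) D := by
  intro hfin
  obtain ⟨x, -, -⟩ := exists_pair_ne X
  have hconst : ∀ a : Subring.center D, (a : D) = single 1 ((a : D).coeff 1) := fun a =>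
    eq_single_one_of_mem_center FreeGroup.eq_one_of_forall_commute a.2
  have hli : LinearIndependent (Subring.center D)
      (fun n : ℕ => (single (FreeGroup.of x ^ n) 1 : D)) := by
    rw [linearIndependent_iff']
    intro s c hc n hn
    have hcoeff : ∀ (t : Finset ℕ) (f : ℕ → D) k, (∑ m ∈ t, f m).coeff k =
        ∑ m ∈ t, (f m).coeff k := fun t f k =>
      map_sum (AddMonoidHom.mk' (fun z : D => z.coeff k) fun _ _ => rfl) f t
    have h1 := congrArg (fun z : D => z.coeff (FreeGroup.of x ^ n)) hc
    simp only [hcoeff, coeff_zero] at h1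
    rw [Finset.sum_eq_single n] at h1
    · have h2 : (c n : D).coeff 1 = 0 := by
        rw [Subring.smul_def, smul_eq_mul, hconst, coeff_single_mul] at h1
        simpa using h1
      refine Subtype.ext ?_
      rw [hconst, h2]
      ext k
      by_cases hk : k = 1
      · subst hk
        simp
      · rw [coeff_single_of_ne _ hk]
        rfl
    · intro m _ hmn
      rw [Subring.smul_def, smul_eq_mul, hconst, coeff_single_mul, coeff_single_of_ne, mul_zero]
      intro h
      refine hmn ?_
      have h3 : FreeGroup.of x ^ n = FreeGroup.of x ^ m := by simpa using h
      exact (injective_pow_iff_not_isOfFinOrder.2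
        (not_isOfFinOrder_of_isMulTorsionFree (FreeGroup.of_ne_one x)) h3).symm
    · exact fun h => absurd hn h
  exact not_finite_iff_infinite.2 inferInstance hli.finite

theorem isSelfInvariant_of_isMaximalSubfield [Nontrivial X] {L : Subfield D}
    (hL : IsMaximalSubfield L) : IsSelfInvariant L := by
  obtain ⟨x₀, y₀, hxy⟩ := exists_pair_ne X
  have hconst : ∀ a : Δ, (single 1 a : D) ∈ L := fun a =>
    hL.center_subset (single_one_mem_center a)
  have hmem : ∀ y : D, (∀ a ∈ L, a * y = y * a) → y ∈ L := fun y hy => by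
    have : y ∈ Set.centralizer (L : Set D) := Set.mem_centralizer_iff.2 hy
    rwa [hL.centralizer_eq] at this
  -- `L` is larger than the field of constants
  obtain ⟨t, htL, g, ht, hg⟩ : ∃ t ∈ L, ∃ g, IsLead t g ∧ g ≠ 1 := by
    by_contra! hcon
    -- Otherwise `L` consists of constants, because an element minus its constant term cannot have
    -- leading exponent 1. Then everything centralizes `L` and so lies in `L`, including two
    -- generators that do not commute.
    refine single_of_mul_ne (Δ := Δ) hxy (hL.mul_comm _ (hmem _ ?_) _ (hmem _ ?_)) <;>
    · intro a ha
      have h0 : a - single 1 (a.coeff 1) = 0 := by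
        by_contra hne
        obtain ⟨g, hg⟩ := exists_isLead hne
        have := hcon _ (L.sub_mem ha (hconst _)) g hg
        subst this
        exact hg.1 (by simp)
      rw [sub_eq_zero.1 h0]
      exact (Semigroup.mem_center_iff.1 (single_one_mem_center _) _).symm
  set C := Subgroup.centralizer {g} with hC
  have hCcomm : ∀ a ∈ (C : Set (FreeGroup X)), ∀ b ∈ (C : Set (FreeGroup X)), a * b = b * a :=
    fun a ha b hb => FreeGroup.commute_of_commute hg
      (Subgroup.mem_centralizer_singleton_iff.1 ha) (Subgroup.mem_centralizer_singleton_iff.1 hb)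
  set s : D := single 1 (t.coeff g)⁻¹ * t with hs
  have hsL : s ∈ L := L.mul_mem (hconst _) htL
  have hscoeff : ∀ k, s.coeff k = (t.coeff g)⁻¹ * t.coeff k := fun k => by
    rw [hs, coeff_single_mul, inv_one, one_mul]
  have hsg : s.coeff g = 1 := by rw [hscoeff, inv_mul_cancel₀ ht.1]
  have hslow : (s - single g 1).supp ⊆ Set.Ioi g := fun k hk => by
    rcases eq_or_ne k g with rfl | hkg
    · exact absurd (by simp [hsg]) hk
    · rw [mem_supp, coeff_sub, coeff_single_of_ne _ hkg, sub_zero, hscoeff] at hk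
      exact lt_of_le_of_ne (ht.2 (right_ne_zero_of_mul hk)) hkg.symm
  obtain ⟨x, p, hx1, hpC, hpg, hconj⟩ := exists_conj_supp_subset_centralizer g hslow
  rw [add_sub_cancel] at hconj
  set s' : D := single g 1 + p
  have hx : x ≠ 0 := by
    rintro rfl
    simp at hx1
  have hs'C : s'.supp ⊆ C := supp_add_subset
    ((supp_single g 1).trans (by simp [hC, Subgroup.mem_centralizer_singleton_iff])) hpC
  have hs'lead : IsLead s' g := by
    refine ⟨?_, supp_add_subset ((supp_single g 1).trans (by simp))
      (hpg.trans Set.Ioi_subset_Ici_self)⟩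
    have : p.coeff g = 0 := by
      by_contra h
      exact lt_irrefl _ (hpg h)
    rw [coeff_add, coeff_single_same, this, add_zero]
    exact one_ne_zero
  let φ : D → D := fun a => x⁻¹ * a * x
  have hφmul : ∀ a b, φ a * φ b = φ (a * b) := fun a b => by
    simp only [φ, mul_assoc, mul_inv_cancel_left₀ hx]
  have hφinj : ∀ a b, φ a = φ b → a = b := fun a b h =>
    mul_left_cancel₀ (inv_ne_zero hx) (mul_right_cancel₀ hx h)
  have hφs : φ s = s' := by
    simp only [φ]
    rw [mul_assoc, hconj, inv_mul_cancel_left₀ hx]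
  have hφL : ∀ a ∈ L, (φ a).supp ⊆ C := fun a ha => by
    refine supp_subset_centralizer_of_commute hs'lead hs'C ?_
    rw [← hφs, hφmul, hφmul, hL.mul_comm a ha s hsL]
  ext b
  constructor
  · rintro (⟨hb0, hb⟩ | rfl)
    swap
    · exact L.zero_mem
    have hbL : ∀ a ∈ L, b * a * b⁻¹ ∈ L := fun a ha => by
      rcases eq_or_ne a 0 with rfl | ha0
      · simp
      · exact (hb a ⟨ha, ha0⟩).1
    have hcomm : ∀ a, φ b * φ a = φ (b * a * b⁻¹) * φ b := fun a => by
      rw [hφmul, hφmul, inv_mul_cancel_right₀ hb0]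
    have hφb : φ b ≠ 0 := mul_ne_zero (mul_ne_zero (inv_ne_zero hx) hb0) hx
    obtain ⟨h, hh⟩ := exists_isLead hφb
    -- Leading exponents in `φ b * s' = φ (b * s * b⁻¹) * φ b` give `h g = k h`. Since `k` is an
    -- exponent of an element of `φ L`, it lies in `C`, so `h` conjugates `g` into `C`.
    have hhC : h ∈ C := by
      have hy0 : φ (b * s * b⁻¹) ≠ 0 := fun h0 => by
        have h1 := hh.mul hs'lead
        rw [← hφs, hcomm, h0, zero_mul] at h1
        exact h1.1 rfl
      obtain ⟨k, hk⟩ := exists_isLead hy0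
      have h1 := hh.mul hs'lead
      rw [← hφs, hcomm] at h1
      have h2 : h * g = k * h := h1.unique (hk.mul hh)
      have hkC : k ∈ C := hφL _ (hbL s hsL) hk.1
      rw [← mul_inv_eq_iff_eq_mul.2 h2] at hkC
      exact Subgroup.mem_centralizer_singleton_iff.2
        (FreeGroup.commute_of_conj_commute (Subgroup.mem_centralizer_singleton_iff.1 hkC))
    have hproj : proj (C : Set (FreeGroup X)) (φ b) ≠ 0 := fun h0 => by
      have h1 := congrArg (fun z : D => z.coeff h) h0
      simp only [coeff_proj_of_mem _ (SetLike.mem_coe.2 hhC), coeff_zero] at h1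
      exact hh.1 h1
    refine hmem b fun a ha => ?_
    -- `φ b` itself is not yet known to be supported in `C`. Its nonzero projection satisfies the
    -- same relation, commutes with the factors from `φ L`, and can be cancelled.
    have h1 := congrArg (proj (C : Set (FreeGroup X))) (hcomm a)
    rw [proj_mul_right C _ (hφL a ha), proj_mul_left C (hφL _ (hbL a ha)),
      mul_comm_of_supp_subset hCcomm (hφL _ (hbL a ha))
        ((supp_proj _ _).trans Set.inter_subset_left)] at h1
    have h2 := hφinj _ _ (mul_left_cancel₀ hproj h1)
    exact (eq_mul_inv_iff_mul_eq₀ hb0).1 h2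
  · intro hb
    rcases eq_or_ne b 0 with rfl | hb0
    · exact Or.inr rfl
    · refine Or.inl ⟨hb0, fun a ha => ⟨L.mul_mem (L.mul_mem hb ha.1) (L.inv_mem hb), ?_⟩⟩
      exact mul_ne_zero (mul_ne_zero hb0 ha.2) (inv_ne_zero hb0)

end Free

end MalcevNeumann

theorem mainTheorem1 (Δ : Type*) [Field Δ] (X : Type*) [LinearOrder X] [Nontrivial X] :
    (∀ L : Subfield (MalcevNeumann Δ (FreeGroup X)), IsMaximalSubfield L → IsSelfInvariant L) ∧
      (∃ a b : MalcevNeumann Δ (FreeGroup X), a * b ≠ b * a) ∧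
      ¬ Module.Finite (Subring.center (MalcevNeumann Δ (FreeGroup X)))
        (MalcevNeumann Δ (FreeGroup X)) := by
  obtain ⟨x, y, hxy⟩ := exists_pair_ne X
  exact ⟨fun L hL => MalcevNeumann.isSelfInvariant_of_isMaximalSubfield hL,
    ⟨_, _, MalcevNeumann.single_of_mul_ne hxy⟩, MalcevNeumann.not_finite_over_center⟩
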